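/- All groups are finite. A subgroup of a group $G$ is called a maximal cyclic subgroup if it is cyclic and not properly contained in any cyclic subgroup of $G$. A covering of $G$ is a family of proper subgroups of $G$ whose union is $G$; it is irredundant if, for each of its members, removing that member leaves a family that is not a covering of $G$. For noncyclic $G$ let $\lambda(G)$ denote the maximal size of an irredundant covering of $G$, and put $\lambda(G)=1$ if $G$ is cyclic. (In every case, $\lambda(G)$ equals the number of maximal cyclic subgroups of $G$.) A family of finite groups is called MCB (maximal cyclic bounded) if, for every natural number $n$, there are, up to isomorphism, only finitely many groups in the family with at most $n$ maximal cyclic subgroups. Theorem. The family of noncyclic finite groups of prime power order is MCB. More precisely, there is an absolute constant $c>0$ such that every noncyclic finite group $G$ of prime power order satisfies $$|G|\le c^{t}\cdot t^{t^2},\qquad\text{where } t=\lambda(G).$$ -/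

import Mathlib

universe u

namespace MaxCyclic

/-- A maximal cyclic subgroup: it is cyclic and is not properly contained in a cyclic subgroup. -/
def IsMaximalCyclic {G : Type u} [Group G] (H : Subgroup G) : Prop :=
  IsCyclic H ∧ ∀ K : Subgroup G, IsCyclic K → ¬ H < K

/-- A covering of `G`: a family of proper subgroups of `G` whose union is `G`. -/
def IsCovering {G : Type u} [Group G] (𝓗 : Set (Subgroup G)) : Prop :=
  (∀ H ∈ 𝓗, H ≠ ⊤) ∧ (⋃ H ∈ 𝓗, (H : Set G)) = Set.univ

/-- An irredundant covering: no member can be removed. -/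
def IsIrredundantCovering {G : Type u} [Group G] (𝓗 : Set (Subgroup G)) : Prop :=
  IsCovering 𝓗 ∧ ∀ H ∈ 𝓗, ¬ IsCovering (𝓗 \ {H})

open Classical in
/-- `λ(G)` for a finite group `G`: the maximal size of an irredundant covering of `G` if `G` is
noncyclic, and `1` if `G` is cyclic. For finite `G` the set of sizes is bounded, and it is nonempty
if `G` is noncyclic, so the supremum is a maximum. -/
noncomputable def lam (G : Type u) [Group G] [Finite G] : ℕ :=
  if IsCyclic G then 1
  else sSup {k : ℕ | ∃ 𝓗 : Set (Subgroup G), IsIrredundantCovering 𝓗 ∧ 𝓗.ncard = k}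

/-- Isomorphism of finite groups, as an equivalence relation. -/
def isoSetoid : Setoid FiniteGrp.{u} where
  r G H := Nonempty (G ≃* H)
  iseqv :=
    ⟨fun _ => ⟨MulEquiv.refl _⟩, fun ⟨e⟩ => ⟨e.symm⟩, fun ⟨e⟩ ⟨f⟩ => ⟨e.trans f⟩⟩

/-- A family of finite groups is maximal cyclic bounded (MCB) if, for every `n`, its members with
at most `n` maximal cyclic subgroups form only finitely many isomorphism classes. -/
def IsMCB (𝓕 : Set FiniteGrp.{u}) : Prop :=
  ∀ n : ℕ, (Quotient.mk isoSetoid ''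
    {G : FiniteGrp.{u} | G ∈ 𝓕 ∧ {H : Subgroup G | IsMaximalCyclic H}.ncard ≤ n}).Finite

end MaxCyclic

/-!
Let `G` be a noncyclic group of order `p ^ n`. Its maximal cyclic subgroups form an irredundant
covering, so there are at most `λ(G)` of them; say there are `t`, and let `D` be their
intersection. The bound comes from `|G| = |G : D| * |D| ≤ t! * p` and `p ≤ t`: it gives
`|G| ≤ t ^ (t + 1) ≤ t ^ (t ^ 2)`, so `c = 1` will do.

* `index_inf_le_factorial` (B. H. Neumann): in an irredundant covering by `t` subgroups the
  intersection has index at most `t!`. If `S` is a proper subfamily with intersection `A`, pick `g`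
  outside all members of `S`. The coset `g A` misses the members of `S`, so it is covered by
  `t - |S|` cosets of the groups `A ⊓ H` with `H ∉ S`, and one of these has index at most `t - |S|`
  in `A`. Adding the members one at a time gives `t!`.
* `card_sInf_isMaximalCyclic_le`: `|D| ≤ p`. Subgroups of a cyclic `p`-group form a chain, so
  `D ≤ ⟨g⟩` for every `g ∉ D`; in particular `D` is central. Choose `x` of order `p` and central
  modulo `D`, and a maximal cyclic subgroup `C` not containing `x`. Some `v ∈ C` satisfies
  `v ^ p = x ^ (-p)`, and `x` and `v` generate a group of class at most two whose commutators have
  exponent `p`. Hence `(x v) ^ (p ^ 2) = 1`, while `D` is a proper subgroup of `⟨x v⟩`.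
* `prime_le_ncard_isMaximalCyclic`: `p ≤ t`, as some maximal cyclic subgroup has index at most `t`.

There are only finitely many groups of bounded order, so the family is MCB.
-/

namespace MaxCyclic

/-! ### The intersection of an irredundant covering -/

open scoped Pointwise in
/-- Induction step of Neumann's bound: if the members of `S` do not cover `G`, then another member
`H` of the covering meets the intersection of `S` in a subgroup whose relative index is at most
the number of members outside `S`. -/
theorem exists_relIndex_inf_le {G : Type*} [Group G] {𝓗 S : Finset (Subgroup G)}
    [DecidableEq (Subgroup G)]
    (hcov : ∀ g : G, ∃ H ∈ 𝓗, g ∈ H) {g : G} (hg : ∀ H ∈ S, g ∉ H) :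
    ∃ H ∈ 𝓗 \ S, H.relIndex (S.inf id) ≤ (𝓗 \ S).card := by
  classical
  set A := S.inf id
  -- The part of `g A` inside `H` is empty or a left coset `g a (A ⊓ H)`.
  have key : ∀ H : Subgroup G, ∃ a : A, (∃ b : A, g * b ∈ H) → g * a ∈ H := fun H => by
    by_cases h : ∃ b : A, g * b ∈ H
    · obtain ⟨b, hb⟩ := h
      exact ⟨b, fun _ => hb⟩
    · exact ⟨1, fun h' => absurd h' h⟩
  choose a ha using key
  have hcovA : ⋃ H ∈ 𝓗 \ S, a H • (H.subgroupOf A : Set A) = Set.univ := by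
    refine Set.eq_univ_of_forall fun b => ?_
    obtain ⟨H, hH, hb⟩ := hcov (g * b)
    have hS : H ∉ S := fun hS => hg H hS <| by
      have hbH : (b : G) ∈ H := (Finset.inf_le (f := id) hS : A ≤ H) b.2
      exact (H.mul_mem_cancel_right hbH).1 hb
    have haH := ha H ⟨b, hb⟩
    simp only [Set.mem_iUnion]
    refine ⟨H, Finset.mem_sdiff.2 ⟨hH, hS⟩, ?_⟩
    rw [mem_leftCoset_iff, SetLike.mem_coe, Subgroup.mem_subgroupOf]
    have := H.mul_mem (H.inv_mem haH) hb
    simpa [mul_assoc] using this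
  obtain ⟨H, hH, -, hle⟩ := Subgroup.exists_index_le_card_of_leftCoset_cover hcovA
  exact ⟨H, hH, hle⟩

/-- Neumann's bound for an irredundant covering. Irredundancy is given by an element of each member
that lies in no other member; the members need not be proper. -/
theorem index_inf_le_factorial {G : Type*} [Group G] (𝓗 : Finset (Subgroup G))
    (hcov : ∀ g : G, ∃ H ∈ 𝓗, g ∈ H)
    (hirr : ∀ H ∈ 𝓗, ∃ g : G, ∀ K ∈ 𝓗, K ≠ H → g ∉ K) :
    (𝓗.inf id).index ≤ 𝓗.card.factorial := by
  classical
  have step : ∀ k ≤ 𝓗.card, ∃ S ⊆ 𝓗, S.card = k ∧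
      (S.inf id).index ≤ 𝓗.card.descFactorial k := by
    intro k
    induction k with
    | zero => exact fun _ => ⟨∅, by simp⟩
    | succ k ih =>
      intro hk
      obtain ⟨S, hS, hcard, hind⟩ := ih (by omega)
      obtain ⟨H₀, hH₀, hH₀S⟩ := Finset.exists_mem_notMem_of_card_lt_card (s := S) (t := 𝓗)
        (by omega)
      obtain ⟨g, hg⟩ := hirr H₀ hH₀
      obtain ⟨H, hH, hle⟩ := exists_relIndex_inf_le (S := S) hcov (g := g)
        fun K hK => hg K (hS hK) fun h => hH₀S (h ▸ hK)
      rw [Finset.mem_sdiff] at hH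
      refine ⟨insert H S, Finset.insert_subset hH.1 hS, by
        rw [Finset.card_insert_of_notMem hH.2, hcard], ?_⟩
      rw [Finset.card_sdiff_of_subset hS, hcard] at hle
      rw [Finset.inf_insert, id, Nat.descFactorial_succ,
        ← Subgroup.relIndex_mul_index (inf_le_right : H ⊓ S.inf id ≤ S.inf id),
        Subgroup.inf_relIndex_right]
      exact Nat.mul_le_mul hle hind
  obtain ⟨S, hS, hcard, hind⟩ := step 𝓗.card le_rfl
  rwa [Finset.eq_of_subset_of_card_le hS hcard.ge, Nat.descFactorial_self] at hind

/-! ### Cyclic subgroups of `p`-groups -/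

theorem _root_.IsPGroup.le_total_of_isCyclic {C : Type*} [Group C] [Finite C] [IsCyclic C] {p : ℕ}
    [Fact p.Prime] (hC : IsPGroup p C) (A B : Subgroup C) : A ≤ B ∨ B ≤ A := by
  classical
  have main : ∀ A B : Subgroup C, Nat.card A ∣ Nat.card B → A ≤ B := by
    intro A B h a ha
    have := Fintype.ofFinite C
    -- `B` has `|B|` elements and they all solve `c ^ |B| = 1`, so it contains every solution.
    have hsub : (B : Set C).toFinset ⊆ Finset.univ.filter fun c : C => c ^ Nat.card B = 1 := by
      intro b hb
      rw [Set.mem_toFinset] at hb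
      simpa using orderOf_dvd_iff_pow_eq_one.1 (B.orderOf_dvd_natCard hb)
    have heq := Finset.eq_of_subset_of_card_le hsub
      ((IsCyclic.card_pow_eq_one_le Nat.card_pos).trans (by
        rw [Set.toFinset_card, ← Nat.card_eq_fintype_card]; rfl))
    have ha' : a ∈ Finset.univ.filter fun c : C => c ^ Nat.card B = 1 := by
      simpa using orderOf_dvd_iff_pow_eq_one.1 ((A.orderOf_dvd_natCard ha).trans h)
    rw [← heq, Set.mem_toFinset] at ha'
    exact ha'
  obtain ⟨a, ha⟩ := IsPGroup.iff_card.1 (hC.to_subgroup A)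
  obtain ⟨b, hb⟩ := IsPGroup.iff_card.1 (hC.to_subgroup B)
  rcases le_total a b with h | h
  · exact .inl (main A B (by rw [ha, hb]; exact pow_dvd_pow p h))
  · exact .inr (main B A (by rw [ha, hb]; exact pow_dvd_pow p h))

theorem _root_.IsPGroup.le_zpowers_of_notMem {G : Type*} [Group G] [Finite G] {p : ℕ}
    [Fact p.Prime] (hG : IsPGroup p G) {C D : Subgroup G} (hC : IsCyclic C) (hDC : D ≤ C)
    {g : G} (hgC : g ∈ C) (hgD : g ∉ D) : D ≤ Subgroup.zpowers g := by
  rcases (hG.to_subgroup C).le_total_of_isCyclic (D.subgroupOf C)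
    ((Subgroup.zpowers g).subgroupOf C) with h | h
  · intro d hd
    exact h (x := ⟨d, hDC hd⟩) hd
  · exact absurd (h (x := ⟨g, hgC⟩) (Subgroup.mem_zpowers g)) hgD

theorem _root_.IsPGroup.exists_pow_notMem_pow_prime_mem {G : Type*} [Group G] {p : ℕ}
    (hG : IsPGroup p G) {D : Subgroup G} {g : G} (hg : g ∉ D) :
    ∃ k : ℕ, g ^ k ∉ D ∧ (g ^ k) ^ p ∈ D := by
  classical
  have hex : ∃ k : ℕ, g ^ p ^ k ∈ D := by
    obtain ⟨k, hk⟩ := hG g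
    exact ⟨k, hk ▸ D.one_mem⟩
  obtain ⟨j, hj⟩ : ∃ j, Nat.find hex = j + 1 := Nat.exists_eq_succ_of_ne_zero fun h => hg <| by
    simpa [h] using Nat.find_spec hex
  refine ⟨p ^ j, Nat.find_min hex (by omega), ?_⟩
  have := Nat.find_spec hex
  rwa [hj, pow_succ, pow_mul] at this

/-- The power formula in class two, with `z` the commutator of `x` and `v`. -/
theorem mul_pow_of_mul_comm_central {G : Type*} [Group G] {x v z : G} (hz : z ∈ Subgroup.center G)
    (hvx : v * x = x * v * z) (n : ℕ) : (x * v) ^ n = x ^ n * v ^ n * z ^ n.choose 2 := by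
  have hzc : ∀ (k : ℕ) (a : G), z ^ k * a = a * z ^ k := fun k a =>
    (Subgroup.mem_center_iff.1 (pow_mem hz k) a).symm
  have hvn : ∀ n : ℕ, v ^ n * x = x * v ^ n * z ^ n := by
    intro n
    induction n with
    | zero => simp
    | succ n ih =>
      rw [pow_succ', mul_assoc, ih, ← mul_assoc, ← mul_assoc, hvx, mul_assoc (x * v),
        ← pow_one z, hzc, pow_one, pow_succ' z]
      group
  induction n with
  | zero => simp
  | succ n ih =>
    calc (x * v) ^ (n + 1) = x ^ n * v ^ n * (z ^ n.choose 2 * (x * v)) := by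
          rw [pow_succ, ih, mul_assoc]
      _ = x ^ n * (v ^ n * x) * (v * z ^ n.choose 2) := by rw [hzc]; group
      _ = x ^ n * x * v ^ n * (z ^ n * v) * z ^ n.choose 2 := by rw [hvn]; group
      _ = x ^ (n + 1) * v ^ (n + 1) * z ^ (n + 1).choose 2 := by
          rw [hzc, Nat.choose_succ_succ' n 1, Nat.choose_one_right, pow_succ x, pow_succ v, pow_add]
          simp only [mul_assoc]

/-! ### The intersection of the maximal cyclic subgroups -/

theorem exists_isMaximalCyclic_mem {G : Type*} [Group G] [Finite G] (g : G) :
    ∃ C : Subgroup G, IsMaximalCyclic C ∧ g ∈ C := by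
  obtain ⟨C, hC, hmax⟩ := Finite.exists_le_maximal (p := fun K : Subgroup G => IsCyclic K)
    (a := Subgroup.zpowers g) inferInstance
  exact ⟨C, ⟨hmax.1, fun K hK hlt => hmax.not_prop_of_gt hlt hK⟩, hC (Subgroup.mem_zpowers g)⟩

theorem IsMaximalCyclic.eq_of_le {G : Type*} [Group G] {H K : Subgroup G} (hH : IsMaximalCyclic H)
    (hK : IsCyclic K) (hle : H ≤ K) : H = K :=
  hle.eq_of_not_lt (hH.2 K hK)

theorem IsMaximalCyclic.exists_forall_notMem {G : Type*} [Group G] {H : Subgroup G}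
    (hH : IsMaximalCyclic H) : ∃ g, ∀ K, IsMaximalCyclic K → K ≠ H → g ∉ K := by
  obtain ⟨g, hg⟩ := (Subgroup.isCyclic_iff_exists_zpowers_eq_top H).1 hH.1
  refine ⟨g, fun K hK hne hgK => hne ?_⟩
  exact (hH.eq_of_le hK.1 (hg ▸ Subgroup.zpowers_le.2 hgK)).symm

theorem IsMaximalCyclic.ne_top {G : Type*} [Group G] {H : Subgroup G} (hH : IsMaximalCyclic H)
    (hcyc : ¬ IsCyclic G) : H ≠ ⊤ := by
  rintro rfl
  have := hH.1
  exact hcyc (isCyclic_of_surjective (Subgroup.topEquiv (G := G)) Subgroup.topEquiv.surjective)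

/-- The bound is attained by the generalized quaternion groups, where the intersection of the
maximal cyclic subgroups is the centre, of order `2`. -/
theorem card_sInf_isMaximalCyclic_le {G : Type*} [Group G] [Finite G] {p : ℕ} [hp : Fact p.Prime]
    (hG : IsPGroup p G) (hcyc : ¬ IsCyclic G) :
    Nat.card (sInf {H : Subgroup G | IsMaximalCyclic H} : Subgroup G) ≤ p := by
  set D := sInf {H : Subgroup G | IsMaximalCyclic H} with hD
  have hDle : ∀ C, IsMaximalCyclic C → D ≤ C := fun C hC => sInf_le hC
  have hDz : ∀ g ∉ D, D ≤ Subgroup.zpowers g := fun g hg => by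
    obtain ⟨C, hC, hgC⟩ := exists_isMaximalCyclic_mem g
    exact hG.le_zpowers_of_notMem hC.1 (hDle C hC) hgC hg
  have hDcen : D ≤ Subgroup.center G := fun d hd => Subgroup.mem_center_iff.2 fun g => by
    obtain ⟨C, hC, hgC⟩ := exists_isMaximalCyclic_mem g
    have := hC.1
    exact congrArg Subtype.val (mul_comm' (⟨g, hgC⟩ : C) ⟨d, hDle C hC hd⟩)
  have hcen : ∀ d ∈ D, ∀ g, g * d = d * g := fun d hd => Subgroup.mem_center_iff.1 (hDcen hd)
  have hnorm : D.Normal := ⟨fun d hd g => by rwa [hcen d hd g, mul_inv_cancel_right]⟩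
  have hDtop : D ≠ ⊤ := fun h => hcyc <| by
    obtain ⟨C, hC, -⟩ := exists_isMaximalCyclic_mem (1 : G)
    exact absurd (top_le_iff.1 (h ▸ hDle C hC)) (hC.ne_top hcyc)
  -- An element `x` whose image in `G ⧸ D` is central of order `p`.
  obtain ⟨x, hxD, hxp, hxc⟩ : ∃ x ∉ D, x ^ p ∈ D ∧ ∀ g, x⁻¹ * g * x * g⁻¹ ∈ D := by
    have : Nontrivial (G ⧸ D) := QuotientGroup.nontrivial_iff.2 hDtop
    have := (hG.to_quotient D).center_nontrivial
    obtain ⟨⟨q, hq⟩, hq1⟩ := exists_ne (1 : Subgroup.center (G ⧸ D))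
    obtain ⟨g, rfl⟩ := QuotientGroup.mk_surjective q
    have hgD : g ∉ D := fun h => hq1 (Subtype.ext ((QuotientGroup.eq_one_iff g).2 h))
    obtain ⟨k, hk, hkp⟩ := hG.exists_pow_notMem_pow_prime_mem hgD
    refine ⟨g ^ k, hk, hkp, fun a => (QuotientGroup.eq_one_iff _).1 ?_⟩
    have hc := Subgroup.mem_center_iff.1 (pow_mem hq k) (a : G ⧸ D)
    rw [QuotientGroup.mk_mul, QuotientGroup.mk_mul, QuotientGroup.mk_mul, QuotientGroup.mk_inv,
      QuotientGroup.mk_inv, QuotientGroup.mk_pow, mul_assoc _ (a : G ⧸ D), hc,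
      inv_mul_cancel_left, mul_inv_cancel]
  obtain ⟨C, hC, hxC⟩ : ∃ C, IsMaximalCyclic C ∧ x ∉ C := by
    simpa [hD, Subgroup.mem_sInf] using hxD
  obtain ⟨y, hyC, hyD⟩ : ∃ y ∈ C, y ∉ D := by
    by_contra! h
    -- If `C ≤ D`, then `C` lies in every maximal cyclic subgroup, so `C` is the only one.
    refine hDtop (eq_top_iff.2 fun g _ => ?_)
    obtain ⟨K, hK, hgK⟩ := exists_isMaximalCyclic_mem g
    have hCK := hC.eq_of_le hK.1 (le_trans h (hDle K hK))
    exact h g (hCK ▸ hgK)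
  -- Write `x ^ (-p)`, an element of `D ≤ ⟨y⟩`, as `y ^ m`; then `p ∣ m`.
  obtain ⟨v, hvC, hvp⟩ : ∃ v ∈ C, v ^ p = (x ^ p)⁻¹ := by
    obtain ⟨m, hm⟩ := mem_powers_iff_mem_zpowers.2 (hDz y hyD (D.inv_mem hxp))
    by_cases hpm : p ∣ m
    · obtain ⟨k, rfl⟩ := hpm
      exact ⟨y ^ k, C.pow_mem hyC k, by rw [← pow_mul, mul_comm]; exact hm⟩
    · -- If `p ∤ m`, then `y` is a power of `y ^ m`, which lies in `D`.
      exfalso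
      obtain ⟨j, hj⟩ := exists_pow_eq_self_of_coprime
        (hG.orderOf_coprime ((Nat.Prime.coprime_iff_not_dvd hp.out).2 hpm) y).symm
      refine hyD (hj ▸ D.pow_mem ?_ j)
      change y ^ m = _ at hm
      exact hm ▸ D.inv_mem hxp
  have hwD : x * v ∉ D := fun h => hxC ((C.mul_mem_cancel_right hvC).1 (hDle C hC h))
  -- The commutator `z` of `x` and `v` is central, and `z ^ p = 1` as `x ^ p` is central.
  obtain ⟨z, hzD, hvx⟩ : ∃ z ∈ D, v * x = x * v * z := by
    refine ⟨x⁻¹ * v * x * v⁻¹, hxc v, ?_⟩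
    rw [mul_assoc x v, hcen _ (hxc v) v]
    group
  have hzp : z ^ p = 1 := by
    have hconj : v * x * v⁻¹ = x * z := by
      rw [hvx, mul_assoc x v, hcen z hzD v, ← mul_assoc, mul_inv_cancel_right]
    have h := congrArg (· ^ p) hconj
    simp only [conj_pow] at h
    rw [hcen _ hxp v, mul_inv_cancel_right,
      Commute.mul_pow (hcen z hzD x : Commute x z)] at h
    exact mul_eq_left.1 h.symm
  have hw : (x * v) ^ p ^ 2 = 1 := by
    -- `(x * v) ^ p` is a power of `z`.
    rw [pow_two, pow_mul, mul_pow_of_mul_comm_central (hDcen hzD) hvx, hvp, mul_inv_cancel, one_mul,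
      ← pow_mul, mul_comm, pow_mul, hzp, one_pow]
  have hlt : Nat.card D < p ^ 2 := by
    refine lt_of_lt_of_le ?_ (Nat.le_of_dvd (pow_pos hp.out.pos 2) (orderOf_dvd_of_pow_eq_one hw))
    rw [← Nat.card_zpowers]
    exact Set.Finite.card_lt_card (Set.toFinite _) (Set.ssubset_iff_of_subset (hDz _ hwD) |>.2
      ⟨_, Subgroup.mem_zpowers _, hwD⟩)
  obtain ⟨n, hn⟩ := IsPGroup.iff_card.1 (hG.to_subgroup D)
  rw [hn] at hlt ⊢
  have := (Nat.pow_lt_pow_iff_right hp.out.one_lt).1 hlt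
  exact (Nat.pow_le_pow_right hp.out.pos (by omega : n ≤ 1)).trans (pow_one p).le

/-! ### The order of a noncyclic `p`-group -/

open scoped Pointwise in
theorem prime_le_ncard_isMaximalCyclic {G : Type*} [Group G] [Finite G] {p : ℕ}
    [hp : Fact p.Prime] (hG : IsPGroup p G) (hcyc : ¬ IsCyclic G) :
    p ≤ {H : Subgroup G | IsMaximalCyclic H}.ncard := by
  classical
  have hfin : {H : Subgroup G | IsMaximalCyclic H}.Finite := Set.toFinite _
  have hcov : ⋃ H ∈ hfin.toFinset, (1 : G) • (H : Set G) = Set.univ :=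
    Set.eq_univ_of_forall fun g => by
      obtain ⟨C, hC, hgC⟩ := exists_isMaximalCyclic_mem g
      simpa using ⟨C, hC, hgC⟩
  obtain ⟨H, hH, -, hle⟩ := Subgroup.exists_index_le_card_of_leftCoset_cover
    (H := fun H : Subgroup G => H) (g := fun _ => (1 : G)) hcov
  rw [← Set.ncard_eq_toFinset_card _ hfin] at hle
  refine le_trans ?_ hle
  obtain ⟨n, hn⟩ := hG.index H
  have hn0 : n ≠ 0 := by
    rintro rfl
    rw [pow_zero, Subgroup.index_eq_one] at hn
    exact (hfin.mem_toFinset.1 hH).ne_top hcyc hn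
  rw [hn]
  exact Nat.le_self_pow hn0 p

theorem card_le_pow_of_ncard_isMaximalCyclic_le {G : Type*} [Group G] [Finite G]
    (hG : IsPrimePow (Nat.card G)) (hcyc : ¬ IsCyclic G) {m : ℕ}
    (hm : {H : Subgroup G | IsMaximalCyclic H}.ncard ≤ m) : Nat.card G ≤ m ^ m ^ 2 := by
  obtain ⟨p, n, hp, -, hn⟩ := (isPrimePow_nat_iff _).1 hG
  have : Fact p.Prime := ⟨hp⟩
  have hGp : IsPGroup p G := IsPGroup.of_card hn.symm
  have hfin : {H : Subgroup G | IsMaximalCyclic H}.Finite := Set.toFinite _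
  have hind := index_inf_le_factorial hfin.toFinset
    (fun g => by simpa using exists_isMaximalCyclic_mem g)
    (fun H hH => by
      obtain ⟨g, hg⟩ := (hfin.mem_toFinset.1 hH).exists_forall_notMem
      exact ⟨g, fun K hK => hg K (hfin.mem_toFinset.1 hK)⟩)
  rw [← Set.ncard_eq_toFinset_card _ hfin, Finset.inf_id_eq_sInf, hfin.coe_toFinset] at hind
  have hpm := (prime_le_ncard_isMaximalCyclic hGp hcyc).trans hm
  have hm2 : 2 ≤ m := hp.two_le.trans hpm
  calc Nat.card G = _ := (Subgroup.card_mul_index _).symm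
    _ ≤ p * m.factorial :=
      Nat.mul_le_mul (card_sInf_isMaximalCyclic_le hGp hcyc) (hind.trans (Nat.factorial_le hm))
    _ ≤ m * m ^ m := Nat.mul_le_mul hpm (Nat.factorial_le_pow m)
    _ = m ^ (m + 1) := (pow_succ' m m).symm
    _ ≤ m ^ m ^ 2 := Nat.pow_le_pow_right (by omega) (by nlinarith)

theorem isIrredundantCovering_isMaximalCyclic {G : Type*} [Group G] [Finite G]
    (hcyc : ¬ IsCyclic G) : IsIrredundantCovering {H : Subgroup G | IsMaximalCyclic H} := by
  refine ⟨⟨fun H hH => IsMaximalCyclic.ne_top hH hcyc, Set.eq_univ_of_forall fun g => ?_⟩,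
    fun H hH hcov => ?_⟩
  · obtain ⟨C, hC, hgC⟩ := exists_isMaximalCyclic_mem g
    exact Set.mem_biUnion hC hgC
  · obtain ⟨g, hg⟩ := IsMaximalCyclic.exists_forall_notMem hH
    obtain ⟨K, hK, hgK⟩ := Set.mem_iUnion₂.1 (hcov.2 ▸ Set.mem_univ g)
    exact hg K hK.1 hK.2 hgK

theorem ncard_isMaximalCyclic_le_lam {G : Type u} [Group G] [Finite G] (hcyc : ¬ IsCyclic G) :
    {H : Subgroup G | IsMaximalCyclic H}.ncard ≤ lam G := by
  rw [lam, if_neg hcyc]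
  refine le_csSup ⟨Nat.card (Subgroup G), ?_⟩ ⟨_, isIrredundantCovering_isMaximalCyclic hcyc, rfl⟩
  rintro _ ⟨𝓗, -, rfl⟩
  exact Set.ncard_le_card 𝓗

/-! ### Finitely many groups of bounded order -/

theorem finite_isoSetoid_image_card_le (N : ℕ) :
    (Quotient.mk isoSetoid '' {G : FiniteGrp.{u} | Nat.card G ≤ N}).Finite := by
  -- Every group of order `k` is isomorphic to a group structure on a fixed `k`-element type.
  have hfin : ∀ k : Fin (N + 1), Finite (Group (ULift.{u} (Fin k))) := fun k =>
    Finite.of_injective (fun g : Group (ULift.{u} (Fin k)) => g.mul) fun g h hgh =>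
      Group.ext (funext fun a => funext fun b => congrFun (congrFun hgh a) b)
  let F : (Σ k : Fin (N + 1), Group (ULift.{u} (Fin k))) → Quotient isoSetoid.{u} := fun s =>
    Quotient.mk isoSetoid (letI := s.2; FiniteGrp.of (ULift.{u} (Fin s.1)))
  refine (Set.finite_range F).subset ?_
  rintro _ ⟨G, hG, rfl⟩
  let e : ULift.{u} (Fin (Nat.card G)) ≃ G := Equiv.ulift.trans (Finite.equivFin G).symm
  exact ⟨⟨⟨Nat.card G, Nat.lt_succ_of_le hG⟩, e.group⟩,
    Quotient.sound ⟨letI := e.group; e.mulEquiv⟩⟩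

end MaxCyclic

theorem theorem1p2 :
    MaxCyclic.IsMCB {G : FiniteGrp.{u} | IsPrimePow (Nat.card G) ∧ ¬ IsCyclic G} ∧
    ∃ c : ℝ, 0 < c ∧ ∀ (G : Type u) [Group G] [Finite G],
      IsPrimePow (Nat.card G) → ¬ IsCyclic G →
        (Nat.card G : ℝ) ≤
          c ^ MaxCyclic.lam G * (MaxCyclic.lam G : ℝ) ^ (MaxCyclic.lam G ^ 2) := by
  refine ⟨fun n => ?_, 1, one_pos, fun G _ _ hG hcyc => ?_⟩
  · refine (MaxCyclic.finite_isoSetoid_image_card_le (n ^ n ^ 2)).subset (Set.image_mono ?_)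
    rintro G ⟨⟨hG, hcyc⟩, hn⟩
    exact MaxCyclic.card_le_pow_of_ncard_isMaximalCyclic_le hG hcyc hn
  · rw [one_pow, one_mul]
    exact_mod_cast MaxCyclic.card_le_pow_of_ncard_isMaximalCyclic_le hG hcyc
      (MaxCyclic.ncard_isMaximalCyclic_le_lam hcyc)
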